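/- Let $n\ge 0$ be an integer and let $D=(D_1,\dots,D_n)$ with $D_j\subseteq[n]=\{1,\dots,n\}$ be a diagram in the $n\times n$ grid, where $D_j$ is the set of rows (numbered from top to bottom) of the boxes in column $j$; write $\#D=\sum_j|D_j|$. For $I\subseteq[n]$, read column $j$ from top to bottom ($i=1,\dots,n$) and record "(" if $i\notin D_j$ and $i\in I$, ")" if $i\in D_j$ and $i\notin I$, and "$\star$" if $i\in D_j$ and $i\in I$. Let $\theta_{D_j}(I)$ be the number of matched pairs of parentheses plus the number of $\star$ in this word (stars are ignored for the matching), and let $\theta_D(I)=\sum_{j=1}^n\theta_{D_j}(I)$. The Schubitope of $D$ is $$\mathcal S_D=\Big\{\alpha\in\mathbb R_{\ge0}^n:\ \sum_{i=1}^n\alpha_i=\#D,\ \ \sum_{i\in I}\alpha_i\le\theta_D(I)\text{ for all }I\subseteq[n]\Big\}.$$ The movable interval $M(D_j)$ is the interval of rows from the topmost row without a box to the bottommost row with a box in column $j$ (empty if one of these rows does not exist or if the first lies below the second). The Schubert matroid $SM_n(D_j)$ is the matroid on $[n]$ whose bases are the sets $T=\{a_1<\dots<a_k\}$ with $k=|D_j|$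 and $a_m\le b_m$ for all $m$, where $D_j=\{b_1<\dots<b_k\}$. For a matroid $M$ on $[n]$, $P(M)\subset\mathbb R^n$ is the convex hull of the indicator vectors of its bases. For a polytope $P\subset\mathbb R^n$ and an integer $t\ge0$ let $i(P,t)=|tP\cap\mathbb Z^n|$; for an integral polytope this is, as a function of $t$, the Ehrhart polynomial of $P$. The polytope $P$ is lattice-free if $P\cap\mathbb Z^n$ is exactly the set of vertices of $P$. **Theorem.** For any diagram $D=(D_1,\dots,D_n)\subseteq[n]^2$, the following conditions are equivalent: 1. The Schubitope $\mathcal S_D$ is lattice-free. 2. $|M(D_i)\cap M(D_j)|\le1$ for all $1\le i<j\le n$. 3. The Ehrhart polynomial of $\mathcal S_D$ factors as $i(\mathcal S_D,t)=\prod_{j=1}^n i(P(SM_n(D_j)),t)$, i.e. this holds for all integers $t\ge0$. -/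

import Mathlib

open scoped Pointwise

namespace Schubitope

/-- A diagram in the `n × n` grid, given as the list of its columns: `D j` is the set of rows of the
boxes in column `j`.  Rows are numbered from top to bottom, so row `0` is the topmost one. -/
abbrev Diagram (n : ℕ) : Type := Fin n → Finset (Fin n)

/-- The number of boxes of a diagram. -/
def Diagram.size {n : ℕ} (D : Diagram n) : ℕ := ∑ j, (D j).card

/-! ### Lattice points, lattice-free polytopes, the Ehrhart counting function -/

/-- The lattice `ℤⁿ` inside `ℝⁿ`. -/
def latticePoints (n : ℕ) : Set (Fin n → ℝ) := {x | ∀ i, ∃ m : ℤ, x i = (m : ℝ)}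

/-- `P` is lattice-free: its lattice points are exactly its vertices. -/
def IsLatticeFree {n : ℕ} (P : Set (Fin n → ℝ)) : Prop :=
  P ∩ latticePoints n = P.extremePoints ℝ

/-- `ehrhart P t` is the number of lattice points in the dilation `t P`. For an integral polytope `P`
this is, as a function of the nonnegative integer `t`, the Ehrhart polynomial of `P`. -/
noncomputable def ehrhart {n : ℕ} (P : Set (Fin n → ℝ)) (t : ℕ) : ℕ :=
  (((t : ℝ) • P) ∩ latticePoints n).ncard

/-! ### Movable intervals -/

/-- The movable interval of a column `C`: the rows from the topmost row without a box to the
bottommost row with a box. It is empty if one of these rows does not exist, or if they come in the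
wrong order. -/
def movableInterval {n : ℕ} (C : Finset (Fin n)) : Finset (Fin n) :=
  {i | (∃ a, a ∉ C ∧ a ≤ i) ∧ (∃ b, b ∈ C ∧ i ≤ b)}

/-! ### The Schubitope -/

/-- The symbols of the words that define the Schubitope: `(`, `)` and `⋆`. -/
inductive Symb : Type
  | opening
  | closing
  | star
  deriving DecidableEq

/-- The word of a column `C` with respect to a set of rows `I`, read from top to bottom. -/
def word {n : ℕ} (I C : Finset (Fin n)) : List Symb :=
  (List.finRange n).filterMap fun i =>
    if i ∈ C then
      (if i ∈ I then some Symb.star else some Symb.closing)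
    else
      (if i ∈ I then some Symb.opening else none)

/-- The number of matched pairs of parentheses in a word, if `k` unmatched opening parentheses
precede it. Stars are ignored. -/
def matchedPairs : ℕ → List Symb → ℕ
  | _, [] => 0
  | k, Symb.opening :: w => matchedPairs (k + 1) w
  | 0, Symb.closing :: w => matchedPairs 0 w
  | k + 1, Symb.closing :: w => matchedPairs k w + 1
  | k, Symb.star :: w => matchedPairs k w

/-- The number of matched pairs of parentheses plus the number of stars in the word of the
column `C`. -/
def thetaColumn {n : ℕ} (C I : Finset (Fin n)) : ℕ :=
  matchedPairs 0 (word I C) + (word I C).count Symb.star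

/-- The sum of the column statistics over all columns of the diagram. -/
def Diagram.theta {n : ℕ} (D : Diagram n) (I : Finset (Fin n)) : ℕ :=
  ∑ j, thetaColumn (D j) I

/-- The Schubitope of a diagram. -/
def Diagram.schubitope {n : ℕ} (D : Diagram n) : Set (Fin n → ℝ) :=
  {x | (∀ i, 0 ≤ x i) ∧ ∑ i, x i = (D.size : ℝ) ∧
    ∀ I : Finset (Fin n), ∑ i ∈ I, x i ≤ (D.theta I : ℝ)}

/-! ### Schubert matroids and matroid base polytopes -/

/-- The Gale order: `T` and `S` have the same cardinality `k`, and the `m`-th smallest element of `T`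
is at most the `m`-th smallest element of `S` for every `m`. -/
def GaleLE {n : ℕ} (T S : Finset (Fin n)) : Prop :=
  ∃ h : T.card = S.card, ∀ m : Fin S.card, T.orderEmbOfFin h m ≤ S.orderEmbOfFin rfl m

theorem card_filter_le_orderEmbOfFin {n k : ℕ} (T : Finset (Fin n)) (h : T.card = k) (m : Fin k) :
    (T.filter (· ≤ T.orderEmbOfFin h m)).card = m + 1 := by
  have : T.filter (· ≤ T.orderEmbOfFin h m)
      = (Finset.Iic m).map (T.orderEmbOfFin h).toEmbedding := by
    ext x
    simp only [Finset.mem_filter, Finset.mem_map, Finset.mem_Iic, RelEmbedding.coe_toEmbedding]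
    constructor
    · rintro ⟨hx, hle⟩
      have hx' : x ∈ Set.range (T.orderEmbOfFin h) := by
        rw [Finset.range_orderEmbOfFin]; exact hx
      obtain ⟨j, rfl⟩ := hx'
      exact ⟨j, by simpa using hle, rfl⟩
    · rintro ⟨j, hj, rfl⟩
      exact ⟨Finset.orderEmbOfFin_mem T h j, by simpa using hj⟩
  rw [this, Finset.card_map, Fin.card_Iic]

/-- The Gale order in terms of the number of elements in the initial segments. -/
theorem galeLE_iff {n : ℕ} (T S : Finset (Fin n)) :
    GaleLE T S ↔ T.card = S.card ∧ ∀ i, (S.filter (· ≤ i)).card ≤ (T.filter (· ≤ i)).card := by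
  constructor
  · rintro ⟨h, hm⟩
    refine ⟨h, fun i => ?_⟩
    have hS : S.filter (· ≤ i) = ((Finset.univ : Finset (Fin S.card)).filter
        (fun m => S.orderEmbOfFin rfl m ≤ i)).map (S.orderEmbOfFin rfl).toEmbedding := by
      conv_lhs => rw [← Finset.map_orderEmbOfFin_univ S rfl]
      rw [Finset.filter_map]
      rfl
    have hT : T.filter (· ≤ i) = ((Finset.univ : Finset (Fin S.card)).filter
        (fun m => T.orderEmbOfFin h m ≤ i)).map (T.orderEmbOfFin h).toEmbedding := by
      conv_lhs => rw [← Finset.map_orderEmbOfFin_univ T h]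
      rw [Finset.filter_map]
      rfl
    rw [hS, hT, Finset.card_map, Finset.card_map]
    refine Finset.card_le_card fun m => ?_
    simp only [Finset.mem_filter, Finset.mem_univ, true_and]
    exact (hm m).trans
  · rintro ⟨h, hi⟩
    refine ⟨h, fun m => ?_⟩
    by_contra! hlt
    have h1 := hi (S.orderEmbOfFin rfl m)
    rw [card_filter_le_orderEmbOfFin] at h1
    have h2 := card_filter_le_orderEmbOfFin T h m
    have h3 : T.filter (· ≤ S.orderEmbOfFin rfl m) ⊂ T.filter (· ≤ T.orderEmbOfFin h m) := by
      refine Finset.ssubset_iff_subset_ne.2 ⟨fun x hx => ?_, fun heq => ?_⟩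
      · simp only [Finset.mem_filter] at hx ⊢
        exact ⟨hx.1, hx.2.trans hlt.le⟩
      · have : T.orderEmbOfFin h m ∈ T.filter (· ≤ T.orderEmbOfFin h m) := by simp
        rw [← heq, Finset.mem_filter] at this
        exact absurd this.2 (not_le.2 hlt)
    have := Finset.card_lt_card h3
    omega

theorem galeLE_exchange {n : ℕ} {S A B : Finset (Fin n)} (hA : GaleLE A S) (hB : GaleLE B S)
    {a : Fin n} (haA : a ∈ A) (haB : a ∉ B) :
    ∃ b ∈ B \ A, GaleLE (insert b (A.erase a)) S := by
  rw [galeLE_iff] at hA hB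
  have hne : (B \ A).Nonempty := by
    rw [Finset.sdiff_nonempty]
    intro hBA
    exact haB ((Finset.eq_of_subset_of_card_le hBA (by omega)) ▸ haA)
  obtain ⟨b, hb, hmin⟩ := Finset.exists_min_image (B \ A) id hne
  have hbA : b ∉ A := (Finset.mem_sdiff.1 hb).2
  refine ⟨b, hb, (galeLE_iff _ _).2 ⟨?_, fun i => ?_⟩⟩
  · rw [Finset.card_insert_of_notMem (fun h => hbA (Finset.mem_of_mem_erase h)),
      Finset.card_erase_of_mem haA]
    have := Finset.card_pos.2 ⟨a, haA⟩
    omega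
  · rw [Finset.filter_insert, Finset.filter_erase]
    by_cases hbi : b ≤ i
    · rw [if_pos hbi, Finset.card_insert_of_notMem (by simp [hbA])]
      have h1 := Finset.pred_card_le_card_erase (s := A.filter (· ≤ i)) (a := a)
      have h2 := hA.2 i
      omega
    · rw [if_neg hbi]
      by_cases hai : a ≤ i
      · refine (hB.2 i).trans (Finset.card_le_card fun x hx => ?_)
        simp only [Finset.mem_filter, Finset.mem_erase] at hx ⊢
        refine ⟨fun h => haB (h ▸ hx.1), ?_, hx.2⟩
        by_contra hxA
        exact hbi ((hmin x (Finset.mem_sdiff.2 ⟨hx.1, hxA⟩)).trans hx.2)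
      · rw [Finset.erase_eq_of_notMem (by simp [hai])]
        exact hA.2 i

/-- The Schubert matroid of `S`: the matroid on all of `Fin n` whose bases are the sets `T` that are
at most `S` in the Gale order. -/
def schubertMatroid {n : ℕ} (S : Finset (Fin n)) : Matroid (Fin n) :=
  Matroid.ofIsBaseOfFinite (E := Set.univ) Set.finite_univ
    (fun B => ∃ T : Finset (Fin n), (T : Set (Fin n)) = B ∧ GaleLE T S)
    ⟨S, S, rfl, rfl, fun _ => le_rfl⟩
    (by
      rintro _ _ ⟨A, rfl, hA⟩ ⟨B, rfl, hB⟩ a ha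
      obtain ⟨b, hb, h⟩ := galeLE_exchange hA hB (a := a) (by simpa using ha.1) (by simpa using ha.2)
      exact ⟨b, by simpa using hb, _, by simp, h⟩)
    (fun _ _ => Set.subset_univ _)

/-- The base polytope of a matroid on `Fin n`: the convex hull of the indicator vectors of
its bases. -/
def basePolytope {n : ℕ} (M : Matroid (Fin n)) : Set (Fin n → ℝ) :=
  convexHull ℝ {x | ∃ B : Set (Fin n), M.IsBase B ∧ x = B.indicator 1}

end Schubitope

namespace Schubitope

/-! ### The rank function of a column -/

/-! The column statistic has a min formula: `thetaColumn C I` is the minimum over cuts `k` of the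
number of rows of `I` above the cut plus the number of boxes of `C` below it. Hence it is
submodular, and it is the rank function of the Schubert matroid of `C`. The Schubitope is therefore
the base polytope of a sum of matroid rank functions, one per column. By Frank's sandwich theorem
(`exists_sum_between`), valid over ℤ as well as ℝ, every point of it, or lattice point of a
dilation, is a sum of such points of the columns. So the sum map on lattice points of `t`-dilations
is always surjective, and condition 3 says that it is injective for all `t` (`ehrhart_eq_prod_iff`).

Within one column the coordinates outside the movable interval are constant, so the difference of
two decompositions consists of vectors of coordinate sum zero supported on movable intervals. If
these overlap in at most one row, such vectors are independent (`eq_zero_of_sum_eq_zero`) and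
decompositions are unique. This gives condition 3; it also gives condition 1, because a lattice
point is then a unique sum of 0/1 vectors, which are vertices of the cube, and vertices of the
Schubitope are integral for every diagram.

Conversely, if two movable intervals share rows `a < b`, both columns have bases `U + a`, `U + b`
and `V + a`, `V + b`. Choosing `a, b` or `b, a` gives the same sum, which is also the midpoint of
the sums for `a, a` and `b, b`. This refutes both condition 3 (at `t = 1`) and condition 1. -/

theorem matchedPairs_le_count (k : ℕ) (w : List Symb) :
    matchedPairs k w ≤ w.count Symb.closing := by
  induction w generalizing k with
  | nil => simp [matchedPairs]
  | cons a w ih =>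
    cases a
    · simpa [matchedPairs] using ih (k + 1)
    · cases k
      · have := ih 0
        simp only [matchedPairs, List.count_cons_self]
        omega
      · simpa [matchedPairs] using ih _
    · simpa [matchedPairs] using ih k

/-- A matched pair either closes in `v`, or opens in `u` or among the `k` pending parentheses. -/
theorem matchedPairs_append_le (k : ℕ) (u v : List Symb) :
    matchedPairs k (u ++ v) ≤ k + u.count Symb.opening + v.count Symb.closing := by
  induction u generalizing k with
  | nil =>
    have := matchedPairs_le_count k v
    simp only [List.nil_append, List.count_nil]
    omega
  | cons a u ih =>
    cases a
    · have := ih (k + 1)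
      simp only [List.cons_append, matchedPairs, List.count_cons_self]
      omega
    · cases k with
      | zero => simpa [matchedPairs] using ih 0
      | succ k =>
        have := ih k
        simp only [List.cons_append, matchedPairs, List.count_cons, beq_iff_eq, reduceCtorEq,
          if_false]
        omega
    · simpa [matchedPairs] using ih k

/-- If some closing parenthesis is unmatched, cut just after the last such one: every opening before
the cut and every closing after it is matched. Otherwise all closings are matched; this case is a
cut before the whole word only when `k = 0`. -/
theorem matchedPairs_eq_or (k : ℕ) (w : List Symb) :
    matchedPairs k w = w.count Symb.closing ∨ ∃ u v, w = u ++ v ∧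
      matchedPairs k w = k + u.count Symb.opening + v.count Symb.closing := by
  induction w generalizing k with
  | nil => simp [matchedPairs]
  | cons a w ih =>
    cases a
    · obtain h | ⟨u, v, rfl, h⟩ := ih (k + 1)
      · exact .inl (by simpa [matchedPairs] using h)
      · refine .inr ⟨Symb.opening :: u, v, rfl, ?_⟩
        simp only [matchedPairs, List.count_cons_self, h]
        omega
    · cases k with
      | zero =>
        obtain h | ⟨u, v, rfl, h⟩ := ih 0
        · exact .inr ⟨[Symb.closing], w, rfl, by simpa [matchedPairs] using h⟩
        · exact .inr ⟨Symb.closing :: u, v, rfl, by simpa [matchedPairs] using h⟩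
      | succ k =>
        obtain h | ⟨u, v, rfl, h⟩ := ih k
        · exact .inl (by simpa [matchedPairs] using h)
        · refine .inr ⟨Symb.closing :: u, v, rfl, ?_⟩
          simp only [matchedPairs, List.count_cons, beq_iff_eq, reduceCtorEq, if_false, h]
          omega
    · obtain h | ⟨u, v, rfl, h⟩ := ih k
      · exact .inl (by simpa [matchedPairs] using h)
      · exact .inr ⟨Symb.star :: u, v, rfl, by simpa [matchedPairs] using h⟩

theorem exists_matchedPairs_zero_eq (w : List Symb) : ∃ u v, w = u ++ v ∧
    matchedPairs 0 w = u.count Symb.opening + v.count Symb.closing := by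
  obtain h | ⟨u, v, h, h'⟩ := matchedPairs_eq_or 0 w
  · exact ⟨[], w, rfl, by simpa using h⟩
  · exact ⟨u, v, h, by simpa using h'⟩

section Theta

variable {n : ℕ}

/-- The letter recorded in a given row. -/
def letter (I C : Finset (Fin n)) (i : Fin n) : Option Symb :=
  if i ∈ C then
    (if i ∈ I then some Symb.star else some Symb.closing)
  else
    (if i ∈ I then some Symb.opening else none)

theorem count_opening_add_count_star (I C : Finset (Fin n)) (l : List (Fin n)) :
    (l.filterMap (letter I C)).count Symb.opening + (l.filterMap (letter I C)).count Symb.star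
      = l.countP (· ∈ I) := by
  induction l with
  | nil => simp
  | cons a l ih =>
    by_cases ha : a ∈ C <;> by_cases hb : a ∈ I <;>
      simp [letter, ha, hb, ← ih] <;> omega

theorem count_closing_add_count_star (I C : Finset (Fin n)) (l : List (Fin n)) :
    (l.filterMap (letter I C)).count Symb.closing + (l.filterMap (letter I C)).count Symb.star
      = l.countP (· ∈ C) := by
  induction l with
  | nil => simp
  | cons a l ih =>
    by_cases ha : a ∈ C <;> by_cases hb : a ∈ I <;>
      simp [letter, ha, hb, ← ih] <;> omega

theorem countP_mem_eq_card (l : List (Fin n)) (hl : l.Nodup) (p : Fin n → Prop) [DecidablePred p]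
    (hp : ∀ i, i ∈ l ↔ p i) (I : Finset (Fin n)) : l.countP (· ∈ I) = (I.filter p).card := by
  rw [List.countP_eq_length_filter, ← List.toFinset_card_of_nodup (hl.filter _)]
  congr 1
  ext i
  simp [hp, and_comm]

theorem countP_take_finRange (k : ℕ) (I : Finset (Fin n)) :
    ((List.finRange n).take k).countP (· ∈ I) = (I.filter (fun i : Fin n => (i : ℕ) < k)).card := by
  refine countP_mem_eq_card _ ((List.nodup_finRange n).sublist (List.take_sublist _ _)) _ ?_ I
  intro i
  rw [List.mem_take_iff_getElem]
  simp only [List.getElem_finRange, List.length_finRange, lt_inf_iff]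
  exact ⟨fun ⟨j, hj, h⟩ => by subst h; simpa using hj.1, fun h => ⟨i, ⟨h, i.2⟩, by simp⟩⟩

theorem countP_drop_finRange (k : ℕ) (I : Finset (Fin n)) :
    ((List.finRange n).drop k).countP (· ∈ I) = (I.filter (fun i : Fin n => k ≤ (i : ℕ))).card := by
  refine countP_mem_eq_card _ ((List.nodup_finRange n).sublist (List.drop_sublist _ _)) _ ?_ I
  intro i
  rw [List.mem_drop_iff_getElem]
  simp only [List.getElem_finRange, List.length_finRange]
  exact ⟨fun ⟨j, hj, h⟩ => by subst h; simp, fun h => ⟨i - k, by omega, by ext; simp; omega⟩⟩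

/-- Stars above the cut join the openings to count rows of `I`; stars below it join the closings to
count boxes of `C`. -/
theorem thetaColumn_le (C I : Finset (Fin n)) (k : ℕ) :
    thetaColumn C I ≤ (I.filter (fun i : Fin n => (i : ℕ) < k)).card
      + (C.filter (fun i : Fin n => k ≤ (i : ℕ))).card := by
  have hw : word I C = ((List.finRange n).take k).filterMap (letter I C)
      ++ ((List.finRange n).drop k).filterMap (letter I C) := by
    rw [← List.filterMap_append, List.take_append_drop]
    rfl
  rw [← countP_take_finRange, ← countP_drop_finRange, ← count_opening_add_count_star I C,
    ← count_closing_add_count_star I C, thetaColumn, hw, List.count_append]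
  have := matchedPairs_append_le 0 (((List.finRange n).take k).filterMap (letter I C))
    (((List.finRange n).drop k).filterMap (letter I C))
  omega

/-- An optimal cut of the word lifts to a cut of the rows. With `thetaColumn_le` this is the min
formula, and later arguments need nothing else about words. -/
theorem exists_thetaColumn_eq (C I : Finset (Fin n)) :
    ∃ k : ℕ, thetaColumn C I = (I.filter (fun i : Fin n => (i : ℕ) < k)).card
      + (C.filter (fun i : Fin n => k ≤ (i : ℕ))).card := by
  obtain ⟨u, v, hw, h⟩ := exists_matchedPairs_zero_eq (word I C)
  have hw' : (List.finRange n).filterMap (letter I C) = u ++ v := hw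
  obtain ⟨l₁, l₂, hl, rfl, rfl⟩ := List.filterMap_eq_append_iff.1 hw'
  refine ⟨l₁.length, ?_⟩
  rw [← countP_take_finRange, ← countP_drop_finRange, hl, List.take_left, List.drop_left,
    ← count_opening_add_count_star I C, ← count_closing_add_count_star I C, thetaColumn, h, hw,
    List.count_append]
  omega

theorem thetaColumn_empty (C : Finset (Fin n)) : thetaColumn C ∅ = 0 := by
  have := thetaColumn_le C ∅ n
  have h : C.filter (fun i : Fin n => n ≤ (i : ℕ)) = ∅ :=
    Finset.filter_eq_empty_iff.2 fun i _ => not_le.2 i.2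
  simpa [h] using this

/-- Take optimal cuts for `I` and `J`; use the upper cut for the union and the lower one for the
intersection. The contributions of `C` cancel. -/
theorem thetaColumn_union_add_inter_le (C I J : Finset (Fin n)) :
    thetaColumn C (I ∪ J) + thetaColumn C (I ∩ J) ≤ thetaColumn C I + thetaColumn C J := by
  have key : ∀ (I J : Finset (Fin n)) (k l : ℕ), k ≤ l →
      ((I ∪ J).filter (fun i : Fin n => (i : ℕ) < k)).card
          + ((I ∩ J).filter (fun i : Fin n => (i : ℕ) < l)).card
        ≤ (I.filter (fun i : Fin n => (i : ℕ) < k)).card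
          + (J.filter (fun i : Fin n => (i : ℕ) < l)).card := by
    intro I J k l hkl
    rw [← Finset.card_union_add_card_inter (I.filter _),
      ← Finset.card_union_add_card_inter ((I ∪ J).filter _)]
    refine add_le_add (Finset.card_le_card ?_) (Finset.card_le_card ?_) <;>
    · intro i
      simp only [Finset.mem_filter, Finset.mem_union, Finset.mem_inter]
      have : (i : ℕ) < k → (i : ℕ) < l := fun h => h.trans_le hkl
      tauto
  obtain ⟨k, hk⟩ := exists_thetaColumn_eq C I
  obtain ⟨l, hl⟩ := exists_thetaColumn_eq C J
  rcases le_total k l with h | h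
  · have h1 := key I J k l h
    have h2 := thetaColumn_le C (I ∪ J) k
    have h3 := thetaColumn_le C (I ∩ J) l
    omega
  · have h1 := key J I l k h
    rw [Finset.union_comm, Finset.inter_comm] at h1
    have h2 := thetaColumn_le C (I ∪ J) l
    have h3 := thetaColumn_le C (I ∩ J) k
    omega

theorem thetaColumn_mono (C : Finset (Fin n)) {I J : Finset (Fin n)} (h : I ⊆ J) :
    thetaColumn C I ≤ thetaColumn C J := by
  obtain ⟨k, hk⟩ := exists_thetaColumn_eq C J
  rw [hk]
  exact (thetaColumn_le C I k).trans
    (Nat.add_le_add_right (Finset.card_le_card (Finset.filter_subset_filter _ h)) _)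

theorem thetaColumn_le_card (C I : Finset (Fin n)) : thetaColumn C I ≤ I.card := by
  refine (thetaColumn_le C I n).trans ?_
  have h : C.filter (fun i : Fin n => n ≤ (i : ℕ)) = ∅ :=
    Finset.filter_eq_empty_iff.2 fun i _ => not_le.2 i.2
  rw [h, Finset.card_empty, add_zero]
  exact Finset.card_filter_le _ _

theorem card_filter_lt_add_card_filter_le (T : Finset (Fin n)) (k : ℕ) :
    (T.filter (fun i : Fin n => (i : ℕ) < k)).card
      + (T.filter (fun i : Fin n => k ≤ (i : ℕ))).card = T.card := by
  simpa only [not_lt] using T.card_filter_add_card_filter_not (fun i : Fin n => (i : ℕ) < k)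

theorem GaleLE.card_filter_le {T C : Finset (Fin n)} (h : GaleLE T C) (k : ℕ) :
    (T.filter (fun i : Fin n => k ≤ (i : ℕ))).card
      ≤ (C.filter (fun i : Fin n => k ≤ (i : ℕ))).card := by
  obtain ⟨hc, h⟩ := (galeLE_iff _ _).1 h
  rcases k with _ | k
  · simp [hc]
  · by_cases hk : k < n
    · have h1 := h ⟨k, hk⟩
      simp only [Fin.le_def] at h1
      have hT := card_filter_lt_add_card_filter_le T (k + 1)
      have hC := card_filter_lt_add_card_filter_le C (k + 1)
      simp only [Nat.lt_succ_iff] at hT hC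
      omega
    · rw [Finset.filter_eq_empty_iff.2 fun i _ => by omega]
      simp

/-- The column statistic dominates the rank function of the Schubert matroid. -/
theorem GaleLE.card_inter_le {T C : Finset (Fin n)} (h : GaleLE T C) (I : Finset (Fin n)) :
    (T ∩ I).card ≤ thetaColumn C I := by
  obtain ⟨k, hk⟩ := exists_thetaColumn_eq C I
  rw [hk, ← card_filter_lt_add_card_filter_le (T ∩ I) k]
  exact add_le_add
    (Finset.card_le_card (Finset.filter_subset_filter _ Finset.inter_subset_right))
    ((Finset.card_le_card (Finset.filter_subset_filter _ Finset.inter_subset_left)).trans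
      (h.card_filter_le k))

theorem galeLE_refl (C : Finset (Fin n)) : GaleLE C C := ⟨rfl, fun _ => le_rfl⟩

theorem thetaColumn_univ (C : Finset (Fin n)) : thetaColumn C Finset.univ = C.card := by
  refine le_antisymm ?_ (by simpa using (galeLE_refl C).card_inter_le Finset.univ)
  simpa using thetaColumn_le C Finset.univ 0

theorem galeLE_of_card_inter_le {T C : Finset (Fin n)} (hc : T.card = C.card)
    (h : ∀ I, (T ∩ I).card ≤ thetaColumn C I) : GaleLE T C := by
  refine (galeLE_iff _ _).2 ⟨hc, fun i => ?_⟩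
  -- Test on the rows strictly below `i`: the cut at `i + 1` then leaves only the boxes of `C` below
  -- `i`.
  have h1 := (h (Finset.univ.filter (fun j => (i : ℕ) + 1 ≤ (j : ℕ)))).trans
    (thetaColumn_le C _ (i + 1))
  have h2 : (Finset.univ.filter (fun j : Fin n => (i : ℕ) + 1 ≤ (j : ℕ))).filter
      (fun j : Fin n => (j : ℕ) < i + 1) = ∅ := by
    ext j
    simp
  rw [h2, Finset.card_empty, zero_add, Finset.inter_filter, Finset.inter_univ] at h1
  have hT := card_filter_lt_add_card_filter_le T (i + 1)
  have hC := card_filter_lt_add_card_filter_le C (i + 1)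
  simp only [Nat.lt_succ_iff] at hT hC
  simp only [Fin.le_def]
  omega

/-- Outside of the movable interval, a row is either a loop or a coloop. -/
theorem loop_or_coloop_of_notMem_movableInterval {C : Finset (Fin n)} {i : Fin n}
    (hi : i ∉ movableInterval C) :
    thetaColumn C {i} = 0 ∨ thetaColumn C (Finset.univ.erase i) + 1 ≤ C.card := by
  by_cases hb : ∃ b, b ∈ C ∧ i ≤ b
  · right
    have ha : ∀ a ≤ i, a ∈ C := by
      intro a hai
      by_contra haC
      exact hi (by simpa [movableInterval] using ⟨⟨a, haC, hai⟩, hb⟩)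
    -- All rows down to `i` are boxes, so with the cut just below `i` the only change from `C.card`
    -- is the loss of row `i`.
    have h1 := thetaColumn_le C (Finset.univ.erase i) (i + 1)
    rw [Finset.filter_erase] at h1
    have h2 := card_filter_lt_add_card_filter_le C (i + 1)
    have h3 : (Finset.univ.filter (fun j : Fin n => (j : ℕ) < i + 1))
        = C.filter (fun j : Fin n => (j : ℕ) < i + 1) := by
      ext j
      simp only [Finset.mem_filter, Finset.mem_univ, true_and]
      exact ⟨fun h => ⟨ha j (Nat.lt_succ_iff.1 h), h⟩, fun h => h.2⟩
    have h4 : i ∈ C.filter (fun j : Fin n => (j : ℕ) < i + 1) := by simp [ha i le_rfl]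
    rw [h3, Finset.card_erase_of_mem h4] at h1
    have := Finset.card_pos.2 ⟨i, h4⟩
    omega
  · left
    push Not at hb
    have h1 := thetaColumn_le C {i} i
    have h2 : C.filter (fun j : Fin n => (i : ℕ) ≤ (j : ℕ)) = ∅ :=
      Finset.filter_eq_empty_iff.2 fun j hj => not_le.2 (hb j hj)
    rw [Finset.filter_singleton, if_neg (lt_irrefl _), h2] at h1
    simpa using h1

theorem card_filter_le_insert {U : Finset (Fin n)} {x : Fin n} (hx : x ∉ U) (i : Fin n) :
    ((insert x U).filter (· ≤ i)).card = (U.filter (· ≤ i)).card + if x ≤ i then 1 else 0 := by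
  rw [Finset.filter_insert]
  split_ifs
  · rw [Finset.card_insert_of_notMem (by simp [hx])]
  · rfl

/-- Two rows in the movable interval can be exchanged in a suitable basis. -/
theorem exists_galeLE_exchange {C : Finset (Fin n)} {a b : Fin n} (hab : a < b)
    (ha : a ∈ movableInterval C) (hb : b ∈ movableInterval C) :
    ∃ U : Finset (Fin n), a ∉ U ∧ b ∉ U ∧ GaleLE (insert a U) C ∧ GaleLE (insert b U) C := by
  simp only [movableInterval, Finset.mem_filter, Finset.mem_univ, true_and] at ha hb
  obtain ⟨⟨u₀, hu₀, hua₀⟩, -⟩ := ha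
  obtain ⟨-, ⟨v₀, hv₀, hbv₀⟩⟩ := hb
  -- `u` is the lowest empty row at or above `a`, and `v` the topmost box at or below `b`. Moving
  -- the box `v` up to `u` gives a basis that contains `a` and avoids `b`.
  obtain ⟨u, hu, hmax⟩ := Finset.exists_max_image
    (Finset.univ.filter fun u => u ∉ C ∧ u ≤ a) id ⟨u₀, by simp [hu₀, hua₀]⟩
  obtain ⟨v, hv, hmin⟩ := Finset.exists_min_image
    (C.filter fun v => b ≤ v) id ⟨v₀, by simp [hv₀, hbv₀]⟩
  simp only [Finset.mem_filter, Finset.mem_univ, true_and, id] at hu hv hmax hmin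
  have huv : u ≠ v := fun h => hu.1 (h ▸ hv.1)
  have hau : a = u ∨ a ∈ C.erase v := by
    by_cases haC : a ∈ C
    · exact .inr (Finset.mem_erase.2 ⟨(hab.trans_le hv.2).ne, haC⟩)
    · exact .inl (le_antisymm (hmax a ⟨haC, le_rfl⟩) hu.2)
  have hbC : b ∉ insert u (C.erase v) := by
    rw [Finset.mem_insert, Finset.mem_erase]
    rintro (rfl | ⟨hbv, hbC⟩)
    · exact absurd hu.2 (not_le.2 hab)
    · exact hbv (le_antisymm hv.2 (hmin b ⟨hbC, le_rfl⟩))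
  -- Since `u ≤ a < b ≤ v`, the basis `U + b` also arises from `C` by upward moves: `v` to `b`, and
  -- `a` to `u` when `a ≠ u`.
  obtain ⟨U, hU⟩ : ∃ U, U = (insert u (C.erase v)).erase a := ⟨_, rfl⟩
  have haU : a ∉ U := by simp [hU]
  have hbU : b ∉ U := fun h => hbC (Finset.mem_of_mem_erase (hU ▸ h))
  have hUa : insert a U = insert u (C.erase v) := by
    rw [hU, Finset.insert_erase (Finset.mem_insert.2 hau)]
  have huC : u ∉ C.erase v := fun h => hu.1 (Finset.mem_of_mem_erase h)
  have hcard : (insert a U).card = C.card := by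
    rw [hUa, Finset.card_insert_of_notMem huC, Finset.card_erase_add_one hv.1]
  have hC : ∀ i, (C.filter (· ≤ i)).card
      = ((C.erase v).filter (· ≤ i)).card + if v ≤ i then 1 else 0 := fun i => by
    rw [← card_filter_le_insert (Finset.notMem_erase v C), Finset.insert_erase hv.1]
  have hAU : ∀ i, ((C.erase v).filter (· ≤ i)).card + (if u ≤ i then 1 else 0)
      = (U.filter (· ≤ i)).card + if a ≤ i then 1 else 0 := fun i => by
    rw [← card_filter_le_insert huC, ← card_filter_le_insert haU, hUa]
  refine ⟨U, haU, hbU, (galeLE_iff _ _).2 ⟨hcard, fun i => ?_⟩,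
    (galeLE_iff _ _).2 ⟨?_, fun i => ?_⟩⟩
  · have h1 := hAU i
    have h2 : v ≤ i → a ≤ i := (hab.le.trans hv.2).trans
    have h3 : a ≤ i → u ≤ i := hu.2.trans
    rw [hC, card_filter_le_insert haU]
    split_ifs at h1 ⊢ <;> omega
  · rw [← hcard, Finset.card_insert_of_notMem haU, Finset.card_insert_of_notMem hbU]
  · have h1 := hAU i
    have h2 : v ≤ i → b ≤ i := hv.2.trans
    have h3 : a ≤ i → u ≤ i := hu.2.trans
    have h4 : b ≤ i → a ≤ i := hab.le.trans
    rw [hC, card_filter_le_insert hbU]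
    split_ifs at h1 ⊢ <;> omega

end Theta

/-! ### Submodular functions and their base polytopes -/

section Submodular

variable {ι κ R : Type*} [DecidableEq ι] [AddCommGroup R] [LinearOrder R] [IsOrderedAddMonoid R]

/-- Frank's sandwich theorem: there is an additive function between a supermodular function and a
submodular function above it. -/
theorem exists_sum_between (s : Finset ι) (p f : Finset ι → R) (hp0 : p ∅ = 0) (hf0 : f ∅ = 0)
    (hp : ∀ X ⊆ s, ∀ Y ⊆ s, p X + p Y ≤ p (X ∪ Y) + p (X ∩ Y))
    (hf : ∀ X ⊆ s, ∀ Y ⊆ s, f (X ∪ Y) + f (X ∩ Y) ≤ f X + f Y)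
    (hpf : ∀ X ⊆ s, p X ≤ f X) :
    ∃ y : ι → R, ∀ X ⊆ s, p X ≤ ∑ i ∈ X, y i ∧ ∑ i ∈ X, y i ≤ f X := by
  induction s using Finset.induction_on generalizing p f with
  | empty =>
    refine ⟨0, fun X hX => ?_⟩
    obtain rfl := Finset.subset_empty.1 hX
    simp [hp0, hf0]
  | insert e s he ih =>
    have hsub : ∀ {X}, X ⊆ s → X ⊆ insert e s := fun h => h.trans (Finset.subset_insert _ _)
    have hins : ∀ {X}, X ⊆ s → insert e X ⊆ insert e s := fun h => Finset.insert_subset_insert _ h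
    have hnot : ∀ {X}, X ⊆ s → e ∉ X := fun h h' => he (h h')
    -- The value at `e` will be the least `a` with `p (insert e X) ≤ f X + a` for all `X ⊆ s`. No
    -- division occurs, so it is an integer over ℤ.
    obtain ⟨X₀, hX₀, hmax⟩ := Finset.exists_max_image s.powerset
      (fun X => p (insert e X) - f X) ⟨∅, Finset.empty_mem_powerset s⟩
    rw [Finset.mem_powerset] at hX₀
    obtain ⟨a, ha⟩ : ∃ a, a = p (insert e X₀) - f X₀ := ⟨_, rfl⟩
    have hlow : ∀ X ⊆ s, p (insert e X) - a ≤ f X := fun X hX => by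
      have := hmax X (Finset.mem_powerset.2 hX)
      rw [sub_le_comm]
      exact this.trans_eq ha.symm
    -- The choice of `a` respects the upper bounds too: uncross `X₀ + e` with `Y` for `p`, and `X₀`
    -- with `Y + e` for `f`.
    have hup : ∀ Y ⊆ s, p Y ≤ f (insert e Y) - a := fun Y hY => by
      have h1 := hp _ (hins hX₀) _ (hsub hY)
      have h2 := hf _ (hsub hX₀) _ (hins hY)
      rw [Finset.insert_union, Finset.insert_inter_of_notMem (hnot hY)] at h1
      rw [Finset.union_insert, Finset.inter_insert_of_notMem (hnot hX₀)] at h2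
      have h3 := hpf _ (hins (Finset.union_subset hX₀ hY))
      have h4 := hpf _ (hsub (Finset.inter_subset_left.trans hX₀ : X₀ ∩ Y ⊆ s))
      have h5 := (h1.trans (add_le_add h3 h4)).trans h2
      rw [ha, le_sub_iff_add_le, add_sub, sub_le_iff_le_add, add_comm (p Y),
        add_comm (f (insert e Y))]
      exact h5
    -- Once `e` has value `a`, the conditions on `X` and on `X + e` merge into one lower and one
    -- upper bound on the sum over `X`.
    obtain ⟨y, hy⟩ := ih (fun X => max (p X) (p (insert e X) - a))
      (fun X => min (f X) (f (insert e X) - a))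
      (by
        have := hlow ∅ (Finset.empty_subset _)
        rw [hf0] at this
        simpa [hp0] using this)
      (by
        have := hup ∅ (Finset.empty_subset _)
        rw [hp0] at this
        simpa [hf0] using this)
      (by
        intro X hX Y hY
        have h1 := hp X (hsub hX) Y (hsub hY)
        have h2 := hp (insert e X) (hins hX) Y (hsub hY)
        have h3 := hp X (hsub hX) (insert e Y) (hins hY)
        have h4 := hp (insert e X) (hins hX) (insert e Y) (hins hY)
        rw [Finset.insert_union, Finset.insert_inter_of_notMem (hnot hY)] at h2
        rw [Finset.union_insert, Finset.inter_insert_of_notMem (hnot hX)] at h3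
        rw [← Finset.insert_inter_distrib, ← Finset.insert_union_distrib] at h4
        rcases max_choice (p X) (p (insert e X) - a) with hX' | hX' <;>
        rcases max_choice (p Y) (p (insert e Y) - a) with hY' | hY' <;>
        simp only [hX', hY']
        · exact h1.trans (add_le_add (le_max_left _ _) (le_max_left _ _))
        · refine le_trans ?_ (add_le_add (le_max_right _ _) (le_max_left _ _))
          rw [add_sub, sub_add_eq_add_sub]
          exact sub_le_sub_right h3 a
        · refine le_trans ?_ (add_le_add (le_max_right _ _) (le_max_left _ _))
          rw [sub_add_eq_add_sub, sub_add_eq_add_sub]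
          exact sub_le_sub_right h2 a
        · refine le_trans ?_ (add_le_add (le_max_right _ _) (le_max_right _ _))
          rw [sub_add_sub_comm, sub_add_sub_comm]
          exact sub_le_sub_right h4 _)
      (by
        intro X hX Y hY
        have h1 := hf X (hsub hX) Y (hsub hY)
        have h2 := hf (insert e X) (hins hX) Y (hsub hY)
        have h3 := hf X (hsub hX) (insert e Y) (hins hY)
        have h4 := hf (insert e X) (hins hX) (insert e Y) (hins hY)
        rw [Finset.insert_union, Finset.insert_inter_of_notMem (hnot hY)] at h2
        rw [Finset.union_insert, Finset.inter_insert_of_notMem (hnot hX)] at h3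
        rw [← Finset.insert_inter_distrib, ← Finset.insert_union_distrib] at h4
        rcases min_choice (f X) (f (insert e X) - a) with hX' | hX' <;>
        rcases min_choice (f Y) (f (insert e Y) - a) with hY' | hY' <;>
        simp only [hX', hY']
        · exact (add_le_add (min_le_left _ _) (min_le_left _ _)).trans h1
        · refine (add_le_add (min_le_right _ _) (min_le_left _ _)).trans ?_
          rw [add_sub, sub_add_eq_add_sub]
          exact sub_le_sub_right h3 a
        · refine (add_le_add (min_le_right _ _) (min_le_left _ _)).trans ?_
          rw [sub_add_eq_add_sub, sub_add_eq_add_sub]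
          exact sub_le_sub_right h2 a
        · refine (add_le_add (min_le_right _ _) (min_le_right _ _)).trans ?_
          rw [sub_add_sub_comm, sub_add_sub_comm]
          exact sub_le_sub_right h4 _)
      (by
        intro X hX
        exact max_le (le_min (hpf X (hsub hX)) (hup X hX))
          (le_min (hlow X hX) (sub_le_sub_right (hpf _ (hins hX)) a)))
    refine ⟨Function.update y e a, fun X hX => ?_⟩
    have hsum : ∀ Z ⊆ s, ∑ i ∈ Z, Function.update y e a i = ∑ i ∈ Z, y i := fun Z hZ =>
      Finset.sum_congr rfl fun i hi =>
        Function.update_of_ne (fun h => hnot hZ (by rwa [h] at hi)) _ _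
    by_cases heX : e ∈ X
    · have hZ : X.erase e ⊆ s := by rwa [← Finset.subset_insert_iff]
      obtain ⟨h1, h2⟩ := hy _ hZ
      rw [Finset.insert_erase heX] at h1 h2
      rw [← Finset.add_sum_erase X _ heX, hsum _ hZ, Function.update_self]
      exact ⟨sub_le_iff_le_add'.1 ((le_max_right _ _).trans h1),
        le_sub_iff_add_le'.1 (h2.trans (min_le_right _ _))⟩
    · have hZ : X ⊆ s := (Finset.subset_insert_iff_of_notMem heX).1 hX
      rw [hsum _ hZ]
      exact ⟨(le_max_left _ _).trans (hy X hZ).1, (hy X hZ).2.trans (min_le_left _ _)⟩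

/-- A submodular set function that vanishes on the empty set. -/
structure IsSubmodular (f : Finset ι → R) : Prop where
  empty : f ∅ = 0
  union_add_inter_le : ∀ X Y, f (X ∪ Y) + f (X ∩ Y) ≤ f X + f Y

omit [IsOrderedAddMonoid R] in
theorem IsSubmodular.zero : IsSubmodular (0 : Finset ι → R) := ⟨rfl, by simp⟩

theorem IsSubmodular.add {f g : Finset ι → R} (hf : IsSubmodular f) (hg : IsSubmodular g) :
    IsSubmodular (f + g) := by
  refine ⟨by simp [hf.empty, hg.empty], fun X Y => ?_⟩
  simp only [Pi.add_apply]
  rw [add_add_add_comm, add_add_add_comm (f X)]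
  exact add_le_add (hf.union_add_inter_le X Y) (hg.union_add_inter_le X Y)

theorem IsSubmodular.sum {f : κ → Finset ι → R} (s : Finset κ) (hf : ∀ j, IsSubmodular (f j)) :
    IsSubmodular (∑ j ∈ s, f j) := by
  classical
  induction s using Finset.induction_on with
  | empty => simpa using IsSubmodular.zero
  | insert j s hj ih => rw [Finset.sum_insert hj]; exact (hf j).add ih

theorem IsSubmodular.nsmul {f : Finset ι → R} (hf : IsSubmodular f) (t : ℕ) :
    IsSubmodular (t • f) := by
  simpa using IsSubmodular.sum (Finset.range t) (fun _ : ℕ => hf)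

variable [Fintype ι]

/-- The base polytope of a set function. -/
def baseSet (f : Finset ι → R) : Set (ι → R) :=
  {x | ∑ i, x i = f Finset.univ ∧ ∀ I : Finset ι, ∑ i ∈ I, x i ≤ f I}

omit [DecidableEq ι] in
theorem baseSet_zero : baseSet (0 : Finset ι → R) = {0} := by
  ext x
  simp only [baseSet, Pi.zero_apply, Set.mem_ofPred_eq, Set.mem_singleton_iff]
  refine ⟨fun ⟨h1, h2⟩ => ?_, by rintro rfl; simp⟩
  have h3 : ∀ i, x i ≤ 0 := fun i => by simpa using h2 {i}
  ext i
  exact (Finset.sum_eq_zero_iff_of_nonpos fun i _ => h3 i).1 h1 i (Finset.mem_univ i)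

omit [DecidableEq ι] in
theorem add_mem_baseSet {f g : Finset ι → R} {x y : ι → R} (hx : x ∈ baseSet f)
    (hy : y ∈ baseSet g) : x + y ∈ baseSet (f + g) := by
  refine ⟨?_, fun I => ?_⟩
  · simp only [Pi.add_apply, Finset.sum_add_distrib, hx.1, hy.1]
  · simp only [Pi.add_apply, Finset.sum_add_distrib]
    exact add_le_add (hx.2 I) (hy.2 I)

omit [DecidableEq ι] in
theorem sum_mem_baseSet {f : κ → Finset ι → R} {x : κ → ι → R} (s : Finset κ)
    (h : ∀ j, x j ∈ baseSet (f j)) : ∑ j ∈ s, x j ∈ baseSet (∑ j ∈ s, f j) := by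
  classical
  induction s using Finset.induction_on with
  | empty => simp [baseSet_zero]
  | insert j s hj ih =>
    rw [Finset.sum_insert hj, Finset.sum_insert hj]
    exact add_mem_baseSet (h j) ih

/-- The function `x - g` is supermodular and lies below `f`; an additive `y` between them splits `x`
as `y + (x - y)`. -/
theorem exists_add_eq_of_mem_baseSet_add {f g : Finset ι → R} (hf : IsSubmodular f)
    (hg : IsSubmodular g) {x : ι → R} (hx : x ∈ baseSet (f + g)) :
    ∃ y ∈ baseSet f, ∃ z ∈ baseSet g, y + z = x := by
  obtain ⟨y, hy⟩ := exists_sum_between Finset.univ (fun X => ∑ i ∈ X, x i - g X) f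
    (by simp [hg.empty]) hf.empty
    (fun X _ Y _ => by
      rw [sub_add_sub_comm, sub_add_sub_comm, Finset.sum_union_inter]
      exact sub_le_sub_left (hg.union_add_inter_le X Y) _)
    (fun X _ Y _ => hf.union_add_inter_le X Y)
    (fun X _ => sub_le_iff_le_add.2 (hx.2 X))
  have hxs := hx.1
  have h1 : ∑ i, y i = f Finset.univ := by
    refine le_antisymm (hy _ subset_rfl).2 ?_
    refine le_trans (le_of_eq ?_) (hy _ subset_rfl).1
    simp [hxs]
  refine ⟨y, ⟨h1, fun I => (hy I (Finset.subset_univ I)).2⟩, x - y, ⟨?_, fun I => ?_⟩, by simp⟩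
  · simp [Finset.sum_sub_distrib, hxs, h1]
  · have := (hy I (Finset.subset_univ I)).1
    simp only [Pi.sub_apply, Finset.sum_sub_distrib]
    exact sub_le_comm.1 this

/-- Every point of the base polytope of a sum of submodular functions is a sum of points of the base
polytopes of the summands. -/
theorem exists_sum_eq_of_mem_baseSet_sum {f : κ → Finset ι → R} (hf : ∀ j, IsSubmodular (f j))
    (s : Finset κ) {x : ι → R} (hx : x ∈ baseSet (∑ j ∈ s, f j)) :
    ∃ y : κ → ι → R, (∀ j ∈ s, y j ∈ baseSet (f j)) ∧ ∑ j ∈ s, y j = x := by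
  classical
  induction s using Finset.induction_on generalizing x with
  | empty =>
    rw [Finset.sum_empty, baseSet_zero] at hx
    exact ⟨0, by simp, by simpa using hx.symm⟩
  | insert j s hj ih =>
    rw [Finset.sum_insert hj] at hx
    obtain ⟨y, hy, z, hz, rfl⟩ := exists_add_eq_of_mem_baseSet_add (hf j) (.sum s hf) hx
    obtain ⟨w, hw, rfl⟩ := ih hz
    have hne : ∀ k ∈ s, k ≠ j := fun k hk h => hj (h ▸ hk)
    refine ⟨Function.update w j y, fun k hk => ?_, ?_⟩
    · rcases Finset.mem_insert.1 hk with rfl | hk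
      · simpa using hy
      · simpa [Function.update_of_ne (hne k hk)] using hw k hk
    · rw [Finset.sum_insert hj, Function.update_self]
      congr 1
      exact Finset.sum_congr rfl fun k hk => Function.update_of_ne (hne k hk) _ _

omit [DecidableEq ι] [IsOrderedAddMonoid R] in
theorem mem_baseSet_le {f : Finset ι → R} {x : ι → R} (hx : x ∈ baseSet f) (i : ι) :
    x i ≤ f {i} := by simpa using hx.2 {i}

theorem le_mem_baseSet {f : Finset ι → R} {x : ι → R} (hx : x ∈ baseSet f) (i : ι) :
    f Finset.univ - f (Finset.univ.erase i) ≤ x i := by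
  have h1 := hx.2 (Finset.univ.erase i)
  have h2 := hx.1
  rw [← Finset.add_sum_erase _ _ (Finset.mem_univ i)] at h2
  rw [← h2, sub_le_iff_le_add]
  exact add_le_add le_rfl h1

theorem finite_baseSet (f : Finset ι → ℤ) : (baseSet f).Finite :=
  (Set.finite_Icc (fun i => f Finset.univ - f (Finset.univ.erase i)) (fun i => f {i})).subset
    fun _ hx => ⟨fun i => le_mem_baseSet hx i, fun i => mem_baseSet_le hx i⟩

end Submodular

/-! ### Extreme points of the base polytope -/

section Extreme

variable {ι : Type*} [DecidableEq ι] [Fintype ι]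

/-- The slack of `x` is nonnegative and submodular, so its zero sets are closed under intersection.
-/
theorem tight_union_inter {f : Finset ι → ℝ} (hf : IsSubmodular f) {x : ι → ℝ} (hx : x ∈ baseSet f)
    {X Y : Finset ι} (hX : ∑ i ∈ X, x i = f X) (hY : ∑ i ∈ Y, x i = f Y) :
    ∑ i ∈ X ∩ Y, x i = f (X ∩ Y) := by
  have h1 := hf.union_add_inter_le X Y
  have h2 := hx.2 (X ∪ Y)
  have h3 := hx.2 (X ∩ Y)
  have h4 := Finset.sum_union_inter (s₁ := X) (s₂ := Y) (f := x)
  linarith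

/-- The least tight set containing a given element. -/
theorem exists_least_tight {f : Finset ι → ℝ} (hf : IsSubmodular f) {x : ι → ℝ}
    (hx : x ∈ baseSet f) (i : ι) :
    ∃ T : Finset ι, i ∈ T ∧ ∑ j ∈ T, x j = f T ∧
      ∀ Y : Finset ι, i ∈ Y → ∑ j ∈ Y, x j = f Y → T ⊆ Y := by
  classical
  obtain ⟨T, hT, hmin⟩ := Finset.exists_min_image
    (Finset.univ.filter fun T : Finset ι => i ∈ T ∧ ∑ j ∈ T, x j = f T) Finset.card
    ⟨Finset.univ, by simpa using hx.1⟩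
  simp only [Finset.mem_filter, Finset.mem_univ, true_and] at hT hmin
  refine ⟨T, hT.1, hT.2, fun Y hiY hY => ?_⟩
  have := hmin (T ∩ Y) ⟨Finset.mem_inter.2 ⟨hT.1, hiY⟩, tight_union_inter hf hx hT.2 hY⟩
  rw [← Finset.eq_of_subset_of_card_le Finset.inter_subset_left this]
  exact Finset.inter_subset_right

/-- One can move in the direction `e i - e j` if every tight set containing `i` contains `j`. -/
theorem exists_move {f : Finset ι → ℝ} {x : ι → ℝ} (hx : x ∈ baseSet f) {i j : ι}
    (h : ∀ Y : Finset ι, i ∈ Y → ∑ k ∈ Y, x k = f Y → j ∈ Y) :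
    ∃ ε > (0 : ℝ), ∀ δ, 0 ≤ δ → δ ≤ ε →
      x + δ • (Pi.single i 1 - Pi.single j 1 : ι → ℝ) ∈ baseSet f := by
  classical
  -- Only sets containing `i` but not `j` lose slack; `ε` is the least slack among them, or `1` if
  -- there are none.
  obtain ⟨ε, hε, hslack⟩ : ∃ ε > 0, ∀ Y : Finset ι, i ∈ Y → j ∉ Y → ∑ k ∈ Y, x k + ε ≤ f Y := by
    rcases (Finset.univ.filter fun Y : Finset ι => i ∈ Y ∧ j ∉ Y).eq_empty_or_nonempty with he | he
    · refine ⟨1, one_pos, fun Y hi hj => ?_⟩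
      have : Y ∈ (Finset.univ.filter fun Y : Finset ι => i ∈ Y ∧ j ∉ Y) := by simp [hi, hj]
      simp [he] at this
    · obtain ⟨Y₀, hY₀, hmin⟩ := Finset.exists_min_image _ (fun Y => f Y - ∑ k ∈ Y, x k) he
      simp only [Finset.mem_filter, Finset.mem_univ, true_and] at hY₀ hmin
      have hlt : ∑ k ∈ Y₀, x k < f Y₀ :=
        lt_of_le_of_ne (hx.2 Y₀) fun heq => hY₀.2 (h Y₀ hY₀.1 heq)
      refine ⟨f Y₀ - ∑ k ∈ Y₀, x k, sub_pos.2 hlt, fun Y hi hj => ?_⟩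
      linarith [hmin Y ⟨hi, hj⟩]
  refine ⟨ε, hε, fun δ h0 hδ => ?_⟩
  have hs : ∀ Y : Finset ι, ∑ k ∈ Y, (x + δ • (Pi.single i 1 - Pi.single j 1 : ι → ℝ)) k
      = ∑ k ∈ Y, x k + δ * ((if i ∈ Y then 1 else 0) - if j ∈ Y then 1 else 0) := by
    intro Y
    simp [Finset.sum_add_distrib, ← Finset.mul_sum, Finset.sum_sub_distrib]
  refine ⟨by rw [hs]; simpa using hx.1, fun Y => ?_⟩
  rw [hs]
  have h1 := hx.2 Y
  by_cases hi : i ∈ Y <;> by_cases hj : j ∈ Y <;> simp only [hi, hj, if_true, if_false]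
  · linarith
  · linarith [hslack Y hi hj]
  · linarith
  · linarith

/-- Among the non-integral coordinates take `i` with the smallest least tight set. The value of `f`
there is an integer, so the set contains another non-integral `j`; by minimality `i` and `j` have
the same least tight set. Then `x` can move both ways along `e i - e j` and is not extreme. -/
theorem exists_int_of_mem_extremePoints {f : Finset ι → ℝ} (hf : IsSubmodular f)
    (hint : ∀ X, ∃ m : ℤ, f X = m) {x : ι → ℝ} (hx : x ∈ (baseSet f).extremePoints ℝ) (i : ι) :
    ∃ m : ℤ, x i = m := by
  classical
  choose T hT htight hleast using exists_least_tight hf hx.1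
  by_contra hi
  obtain ⟨i, hi, hmin⟩ := Finset.exists_min_image
    (Finset.univ.filter fun i => ¬ ∃ m : ℤ, x i = m) (fun i => (T i).card) ⟨i, by simpa using hi⟩
  rw [Finset.mem_filter] at hi
  obtain ⟨j, hjT, hji, hj⟩ : ∃ j ∈ T i, j ≠ i ∧ ¬ ∃ m : ℤ, x j = m := by
    by_contra! hall
    obtain ⟨m, hm⟩ := hint (T i)
    choose! z hz using fun j (hj : j ∈ (T i).erase i) =>
      hall j (Finset.mem_of_mem_erase hj) (Finset.ne_of_mem_erase hj)
    have h1 := htight i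
    rw [← Finset.add_sum_erase _ _ (hT i), Finset.sum_congr rfl hz, hm] at h1
    exact hi.2 ⟨m - ∑ j ∈ (T i).erase i, z j, by push_cast; linarith⟩
  have hTji : T j = T i := Finset.eq_of_subset_of_card_le (hleast j _ hjT (htight i))
    (hmin j (by simpa using hj))
  obtain ⟨ε, hε, h1⟩ := exists_move hx.1 (i := i) (j := j) fun Y hiY hY => hleast i Y hiY hY hjT
  obtain ⟨δ, hδ, h2⟩ := exists_move hx.1 (i := j) (j := i) fun Y hjY hY =>
    hleast j Y hjY hY (hTji ▸ hT i)
  have hpos : 0 < min ε δ := lt_min hε hδ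
  have h3 := h1 (min ε δ) hpos.le (min_le_left _ _)
  have h4 := h2 (min ε δ) hpos.le (min_le_right _ _)
  have h5 := hx.2 h3 h4 ⟨1 / 2, 1 / 2, by norm_num, by norm_num, by norm_num, by
    ext k
    simp only [Pi.add_apply, Pi.smul_apply, Pi.sub_apply, smul_eq_mul]
    ring⟩
  have h6 := congrFun h5 i
  simp [Pi.single_eq_of_ne hji.symm, hpos.ne'] at h6

end Extreme
/-! ### Base polytopes of columns -/

section Columns

variable {n : ℕ} (R : Type*) [Ring R] [LinearOrder R] [IsStrictOrderedRing R]

/-- The rank function of the Schubert matroid of a column, with values in an ordered ring. -/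
def columnRank (C : Finset (Fin n)) : Finset (Fin n) → R := fun I => (thetaColumn C I : R)

theorem isSubmodular_columnRank (C : Finset (Fin n)) : IsSubmodular (columnRank R C) := by
  refine ⟨by simp [columnRank, thetaColumn_empty], fun X Y => ?_⟩
  simp only [columnRank]
  exact_mod_cast thetaColumn_union_add_inter_le C X Y

/-- The indicator vector of a finite set. -/
def indicatorVec (T : Finset (Fin n)) : Fin n → R := fun i => if i ∈ T then 1 else 0

omit [LinearOrder R] [IsStrictOrderedRing R] in
theorem sum_indicatorVec (T I : Finset (Fin n)) :
    ∑ i ∈ I, indicatorVec R T i = ((T ∩ I).card : R) := by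
  simp [indicatorVec, Finset.inter_comm]

omit [LinearOrder R] [IsStrictOrderedRing R] in
theorem indicatorVec_insert {p : Fin n} {U : Finset (Fin n)} (hp : p ∉ U) :
    indicatorVec R (insert p U) = indicatorVec R U + Pi.single p 1 := by
  ext k
  by_cases hk : k = p
  · subst hk
    simp [indicatorVec, hp]
  · simp [indicatorVec, hk]

variable {R}

theorem indicatorVec_mem_baseSet {T C : Finset (Fin n)} (h : GaleLE T C) :
    indicatorVec R T ∈ baseSet (columnRank R C) := by
  refine ⟨?_, fun I => ?_⟩
  · rw [sum_indicatorVec, Finset.inter_univ, columnRank, thetaColumn_univ, h.1]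
  · rw [sum_indicatorVec, columnRank]
    exact_mod_cast h.card_inter_le I

theorem nonneg_of_mem_baseSet_columnRank {C : Finset (Fin n)} {x : Fin n → R}
    (hx : x ∈ baseSet (columnRank R C)) (i : Fin n) : 0 ≤ x i := by
  refine le_trans (sub_nonneg.2 ?_) (le_mem_baseSet hx i)
  simp only [columnRank]
  exact_mod_cast thetaColumn_mono C (Finset.subset_univ _)

theorem le_one_of_mem_baseSet_columnRank {C : Finset (Fin n)} {x : Fin n → R}
    (hx : x ∈ baseSet (columnRank R C)) (i : Fin n) : x i ≤ 1 := by
  refine (mem_baseSet_le hx i).trans ?_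
  simp only [columnRank]
  exact_mod_cast thetaColumn_le_card C {i}

/-- Coordinates lie between 0 and 1, so integral points are indicator vectors, and the rank
inequalities characterize bases. -/
theorem exists_galeLE_of_mem_baseSet_columnRank {C : Finset (Fin n)} {x : Fin n → ℤ}
    (hx : x ∈ baseSet (columnRank ℤ C)) : ∃ T, GaleLE T C ∧ x = indicatorVec ℤ T := by
  have hxT : x = indicatorVec ℤ (Finset.univ.filter fun i => x i = 1) := by
    ext i
    have h0 := nonneg_of_mem_baseSet_columnRank hx i
    have h1 := le_one_of_mem_baseSet_columnRank hx i
    by_cases hi : x i = 1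
    · simp [indicatorVec, hi]
    · simp only [indicatorVec, Finset.mem_filter, Finset.mem_univ, true_and, hi, if_false]
      omega
  refine ⟨_, galeLE_of_card_inter_le ?_ fun I => ?_, hxT⟩
  · have h := hx.1
    rw [hxT, sum_indicatorVec, Finset.inter_univ, columnRank, thetaColumn_univ] at h
    exact_mod_cast h
  · have h := hx.2 I
    rw [hxT, sum_indicatorVec, columnRank] at h
    exact_mod_cast h

/-- Outside of the movable interval all points of a dilated base polytope have the same
coordinates. -/
theorem eq_of_mem_baseSet_of_notMem_movableInterval {C : Finset (Fin n)} {t : ℕ} {x y : Fin n → R}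
    (hx : x ∈ baseSet (t • columnRank R C)) (hy : y ∈ baseSet (t • columnRank R C)) {i : Fin n}
    (hi : i ∉ movableInterval C) : x i = y i := by
  -- The general upper and lower bounds on coordinate `i` coincide for a loop or a coloop.
  have key : (t • columnRank R C) {i}
      ≤ (t • columnRank R C) Finset.univ - (t • columnRank R C) (Finset.univ.erase i) := by
    rw [le_sub_iff_add_le]
    simp only [Pi.smul_apply, columnRank, ← smul_add]
    refine nsmul_le_nsmul_right ?_ t
    have h1 := thetaColumn_mono C (Finset.subset_univ (Finset.univ.erase i))
    have h2 : thetaColumn C {i} ≤ 1 := thetaColumn_le_card C {i}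
    have h3 := loop_or_coloop_of_notMem_movableInterval hi
    rw [← thetaColumn_univ C] at h3
    have h4 : thetaColumn C {i} + thetaColumn C (Finset.univ.erase i)
      ≤ thetaColumn C Finset.univ := by omega
    exact_mod_cast h4
  exact le_antisymm ((mem_baseSet_le hx i).trans (key.trans (le_mem_baseSet hy i)))
    ((mem_baseSet_le hy i).trans (key.trans (le_mem_baseSet hx i)))

theorem mem_movableInterval_of_le {C : Finset (Fin n)} {p q r : Fin n}
    (hp : p ∈ movableInterval C) (hr : r ∈ movableInterval C) (hpq : p ≤ q) (hqr : q ≤ r) :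
    q ∈ movableInterval C := by
  simp only [movableInterval, Finset.mem_filter, Finset.mem_univ, true_and] at hp hr ⊢
  obtain ⟨⟨a, ha, hap⟩, -⟩ := hp
  obtain ⟨-, b, hb, hrb⟩ := hr
  exact ⟨⟨a, ha, hap.trans hpq⟩, b, hb, hqr.trans hrb⟩

omit [LinearOrder R] [IsStrictOrderedRing R] in
/-- Vectors with coordinate sum zero that are supported on movable intervals with small overlaps are
linearly independent. -/
theorem eq_zero_of_sum_eq_zero {D : Diagram n}
    (hD : ∀ i j, i ≠ j → (movableInterval (D i) ∩ movableInterval (D j)).card ≤ 1)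
    {d : Fin n → Fin n → R} (hsupp : ∀ j, ∀ i ∉ movableInterval (D j), d j i = 0)
    (hd : ∀ j, ∑ i, d j i = 0) (hsum : ∑ j, d j = 0) (j i : Fin n) : d j i = 0 := by
  classical
  by_contra hji
  -- Take the lowest row `r` at which some vector is nonzero. Since the vectors sum to zero, a
  -- second one is nonzero there.
  obtain ⟨r, hr, hmax⟩ := Finset.exists_max_image
    (Finset.univ.filter fun r => ∃ j, d j r ≠ 0) id ⟨i, by simpa using ⟨j, hji⟩⟩
  simp only [Finset.mem_filter, Finset.mem_univ, true_and, id] at hr hmax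
  obtain ⟨j, hj⟩ := hr
  obtain ⟨k, hkj, hk⟩ : ∃ k, k ≠ j ∧ d k r ≠ 0 := by
    by_contra! h
    have h1 := congrFun hsum r
    rw [Finset.sum_apply, Finset.sum_eq_single j (fun k _ hk => h k hk) (by simp)] at h1
    exact hj h1
  have hmem : ∀ k, d k r ≠ 0 → 0 < (r : ℕ) ∧ r ∈ movableInterval (D k) ∧
      ∀ p : Fin n, (p : ℕ) + 1 = r → p ∈ movableInterval (D k) := by
    intro k hk
    have hin : ∀ i, d k i ≠ 0 → i ∈ movableInterval (D k) := fun i hi => by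
      by_contra h
      exact hi (hsupp k i h)
    -- Coordinate sum zero forces another nonzero row, necessarily above `r`; the movable interval
    -- then contains the row just above `r`. Two columns would share both rows.
    obtain ⟨q, hq, hqr⟩ : ∃ q, d k q ≠ 0 ∧ q ≠ r := by
      by_contra! h
      have h1 := hd k
      rw [Finset.sum_eq_single r (fun q _ hq => by
        by_contra h'
        exact hq (h q h')) (by simp)] at h1
      exact hk h1
    have hlt : (q : ℕ) < r := lt_of_le_of_ne (hmax q ⟨k, hq⟩) (fun h => hqr (Fin.ext h))
    refine ⟨by omega, hin r hk, fun p hp => ?_⟩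
    exact mem_movableInterval_of_le (hin q hq) (hin r hk) (Fin.le_def.2 (by omega))
      (Fin.le_def.2 (by omega))
  obtain ⟨h0, hrj, hpj⟩ := hmem j hj
  obtain ⟨-, hrk, hpk⟩ := hmem k hk
  obtain ⟨p, hp⟩ : ∃ p : Fin n, (p : ℕ) + 1 = r := ⟨⟨r - 1, by omega⟩, by simp; omega⟩
  refine absurd (hD k j hkj) (not_le.2 (Finset.one_lt_card.2 ⟨p, ?_, r, ?_, ?_⟩))
  · exact Finset.mem_inter.2 ⟨hpk p hp, hpj p hp⟩
  · exact Finset.mem_inter.2 ⟨hrk, hrj⟩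
  · rintro rfl
    omega

/-- If the movable intervals have small overlaps, then the decomposition of a point into points of
the dilated base polytopes of the columns is unique. -/
theorem eq_of_sum_eq_sum {D : Diagram n}
    (hD : ∀ i j, i ≠ j → (movableInterval (D i) ∩ movableInterval (D j)).card ≤ 1) {t : ℕ}
    {x y : Fin n → Fin n → R} (hx : ∀ j, x j ∈ baseSet (t • columnRank R (D j)))
    (hy : ∀ j, y j ∈ baseSet (t • columnRank R (D j))) (h : ∑ j, x j = ∑ j, y j) : x = y := by
  ext j i
  refine sub_eq_zero.1 (eq_zero_of_sum_eq_zero hD (d := x - y) (fun j i hi => ?_) (fun j => ?_)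
    ?_ j i)
  · exact sub_eq_zero.2 (eq_of_mem_baseSet_of_notMem_movableInterval (hx j) (hy j) hi)
  · simp [Finset.sum_sub_distrib, (hx j).1, (hy j).1]
  · simp [Finset.sum_sub_distrib, h]

/-- Two columns whose movable intervals share two rows have bases that can be modified
independently in these two rows. -/
theorem exists_exchange_of_one_lt_card {D : Diagram n} {i j : Fin n} (hij : i ≠ j)
    (h : 1 < (movableInterval (D i) ∩ movableInterval (D j)).card) :
    ∃ (a b : Fin n) (B : Fin n → Finset (Fin n)) (T : Fin n → Fin n → Fin n → Finset (Fin n)),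
      a ≠ b ∧ (∀ p q, (p = a ∨ p = b) → (q = a ∨ q = b) → ∀ k, GaleLE (T p q k) (D k)) ∧
      a ∈ T a b i ∧ a ∉ T b a i ∧
      ∀ p q, (p = a ∨ p = b) → (q = a ∨ q = b) → ∀ (R : Type) [Ring R],
        ∑ k, indicatorVec R (T p q k)
          = ∑ k, indicatorVec R (B k) + Pi.single p 1 + Pi.single q 1 := by
  obtain ⟨a, ha, b, hb, hab⟩ : ∃ a ∈ movableInterval (D i) ∩ movableInterval (D j),
      ∃ b ∈ movableInterval (D i) ∩ movableInterval (D j), a < b := by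
    obtain ⟨a, ha, b, hb, hab⟩ := Finset.one_lt_card.1 h
    rcases lt_or_gt_of_ne hab with h | h
    · exact ⟨a, ha, b, hb, h⟩
    · exact ⟨b, hb, a, ha, h⟩
  rw [Finset.mem_inter] at ha hb
  obtain ⟨U, haU, hbU, hUa, hUb⟩ := exists_galeLE_exchange hab ha.1 hb.1
  obtain ⟨V, haV, hbV, hVa, hVb⟩ := exists_galeLE_exchange hab ha.2 hb.2
  -- Column `i` uses the basis `U + p`, column `j` uses `V + q`, all others keep `D k`; the total is
  -- symmetric in `p` and `q`.
  refine ⟨a, b, fun k => if k = i then U else if k = j then V else D k,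
    fun p q k => if k = i then insert p U else if k = j then insert q V else D k, hab.ne,
    fun p q hp hq k => ?_, by simp, by simp [haU, hab.ne], fun p q hp hq R _ => ?_⟩
  · dsimp only
    split_ifs with h1 h2
    · subst h1
      rcases hp with rfl | rfl <;> assumption
    · subst h2
      rcases hq with rfl | rfl <;> assumption
    · exact galeLE_refl _
  · have hpU : p ∉ U := by rcases hp with rfl | rfl <;> assumption
    have hqV : q ∉ V := by rcases hq with rfl | rfl <;> assumption
    have : ∀ k, indicatorVec R (if k = i then insert p U else if k = j then insert q V else D k)
        = indicatorVec R (if k = i then U else if k = j then V else D k)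
          + (if k = i then Pi.single p 1 else 0) + (if k = j then Pi.single q 1 else 0) := by
      intro k
      split_ifs with h1 h2 h2
      · exact absurd (h1.symm.trans h2) hij
      · rw [indicatorVec_insert R hpU, add_zero]
      · rw [indicatorVec_insert R hqV, add_zero]
      · simp
    rw [Finset.sum_congr rfl fun k _ => this k]
    simp [Finset.sum_add_distrib]

end Columns

/-! ### Lattice points -/

section Lattice

variable {n : ℕ}

/-- An integer vector as a real vector. -/
def castVec (z : Fin n → ℤ) : Fin n → ℝ := fun i => (z i : ℝ)

theorem castVec_injective : Function.Injective (castVec (n := n)) := fun x y h => by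
  ext i
  exact Int.cast_injective (α := ℝ) (congrFun h i)

theorem castVec_sum {κ : Type*} (s : Finset κ) (z : κ → Fin n → ℤ) :
    castVec (∑ j ∈ s, z j) = ∑ j ∈ s, castVec (z j) := by
  ext i
  simp [castVec, Finset.sum_apply]

theorem castVec_indicatorVec (T : Finset (Fin n)) :
    castVec (indicatorVec ℤ T) = indicatorVec ℝ T := by
  ext i
  simp [castVec, indicatorVec]

theorem mem_latticePoints_iff {x : Fin n → ℝ} : x ∈ latticePoints n ↔ ∃ z, castVec z = x :=
  ⟨fun h => by
    choose z hz using h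
    exact ⟨z, funext fun i => (hz i).symm⟩, by
    rintro ⟨z, rfl⟩ i
    exact ⟨z i, rfl⟩⟩

theorem ehrhart_eq_card {P : Set (Fin n → ℝ)} {t : ℕ} {A : Set (Fin n → ℤ)}
    (h : ∀ z, castVec z ∈ (t : ℝ) • P ↔ z ∈ A) : ehrhart P t = Nat.card A := by
  have : ((t : ℝ) • P) ∩ latticePoints n = castVec '' A := by
    ext x
    simp only [Set.mem_inter_iff, mem_latticePoints_iff, Set.mem_image]
    constructor
    · rintro ⟨hx, z, rfl⟩
      exact ⟨z, (h z).1 hx, rfl⟩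
    · rintro ⟨z, hz, rfl⟩
      exact ⟨(h z).2 hz, z, rfl⟩
  rw [ehrhart, this, Set.ncard_image_of_injective _ castVec_injective, Nat.card_coe_set_eq]

theorem castVec_mem_baseSet_iff {f : Finset (Fin n) → ℤ} {g : Finset (Fin n) → ℝ}
    (h : ∀ I, g I = f I) {z : Fin n → ℤ} : castVec z ∈ baseSet g ↔ z ∈ baseSet f := by
  simp only [baseSet, castVec, Set.mem_ofPred_eq, h]
  norm_cast

theorem convex_baseSet (f : Finset (Fin n) → ℝ) : Convex ℝ (baseSet f) := by
  intro x hx y hy a b ha hb hab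
  have h : ∀ I : Finset (Fin n), ∑ i ∈ I, (a • x + b • y) i
      = a * ∑ i ∈ I, x i + b * ∑ i ∈ I, y i := fun I => by
    simp [Finset.sum_add_distrib, Finset.mul_sum]
  refine ⟨?_, fun I => ?_⟩
  · rw [h, hx.1, hy.1, ← add_mul, hab, one_mul]
  · rw [h]
    calc _ ≤ a * f I + b * f I := add_le_add (mul_le_mul_of_nonneg_left (hx.2 I) ha)
            (mul_le_mul_of_nonneg_left (hy.2 I) hb)
      _ = f I := by rw [← add_mul, hab, one_mul]

theorem smul_baseSet {f : Finset (Fin n) → ℝ} (hf : (baseSet f).Nonempty) (t : ℕ) :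
    (t : ℝ) • baseSet f = baseSet (t • f) := by
  -- Nonemptiness matters for `t = 0`: the base set of the zero function is `{0}`, while the zero
  -- dilate of the empty set is empty.
  rcases Nat.eq_zero_or_pos t with rfl | ht
  · rw [Nat.cast_zero, Set.zero_smul_set hf, zero_smul, baseSet_zero]
    rfl
  · have ht' : (0 : ℝ) < t := Nat.cast_pos.2 ht
    ext x
    rw [Set.mem_smul_set_iff_inv_smul_mem₀ ht'.ne']
    simp only [baseSet, Set.mem_ofPred_eq, Pi.smul_apply, smul_eq_mul, nsmul_eq_mul,
      ← Finset.mul_sum]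
    simp only [inv_mul_le_iff₀ ht', inv_mul_eq_iff_eq_mul₀ ht'.ne']

theorem isBase_schubertMatroid_iff {C : Finset (Fin n)} {B : Set (Fin n)} :
    (schubertMatroid C).IsBase B ↔ ∃ T : Finset (Fin n), (T : Set (Fin n)) = B ∧ GaleLE T C :=
  Iff.rfl

theorem indicatorVec_mem_basePolytope {T C : Finset (Fin n)} (h : GaleLE T C) :
    indicatorVec ℝ T ∈ basePolytope (schubertMatroid C) :=
  subset_convexHull ℝ _ ⟨T, isBase_schubertMatroid_iff.2 ⟨T, rfl, h⟩, by
    ext i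
    simp [indicatorVec, Set.indicator_apply]⟩

theorem basePolytope_subset_baseSet (C : Finset (Fin n)) :
    basePolytope (schubertMatroid C) ⊆ baseSet (columnRank ℝ C) := by
  refine convexHull_min ?_ (convex_baseSet _)
  rintro _ ⟨B, hB, rfl⟩
  obtain ⟨T, rfl, hT⟩ := isBase_schubertMatroid_iff.1 hB
  convert indicatorVec_mem_baseSet (R := ℝ) hT using 1
  ext i
  simp [indicatorVec, Set.indicator_apply]

theorem nonempty_baseSet_columnRank (C : Finset (Fin n)) : (baseSet (columnRank ℝ C)).Nonempty :=
  ⟨_, indicatorVec_mem_baseSet (galeLE_refl C)⟩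

/-- For the converse, split `z` over ℤ into `t` integral points of the undilated base set. Each is a
basis vector, and `z / t` is their average. Equality of the two real polytopes is not needed. -/
theorem castVec_mem_smul_basePolytope_iff {C : Finset (Fin n)} {t : ℕ} {z : Fin n → ℤ} :
    castVec z ∈ (t : ℝ) • basePolytope (schubertMatroid C)
      ↔ z ∈ baseSet (t • columnRank ℤ C) := by
  constructor
  · intro h
    have h1 := Set.smul_set_mono (a := (t : ℝ)) (basePolytope_subset_baseSet C) h
    rw [smul_baseSet (nonempty_baseSet_columnRank C)] at h1
    exact (castVec_mem_baseSet_iff (by simp [columnRank])).1 h1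
  · intro h
    obtain ⟨y, hy, rfl⟩ := exists_sum_eq_of_mem_baseSet_sum
      (f := fun _ : ℕ => columnRank ℤ C) (fun _ => isSubmodular_columnRank ℤ C)
      (Finset.range t) (x := z) (by simpa using h)
    have hmem : ∀ s ∈ Finset.range t, castVec (y s) ∈ basePolytope (schubertMatroid C) := by
      intro s hs
      obtain ⟨T, hT, h⟩ := exists_galeLE_of_mem_baseSet_columnRank (hy s hs)
      rw [h, castVec_indicatorVec]
      exact indicatorVec_mem_basePolytope hT
    rcases Nat.eq_zero_or_pos t with rfl | ht
    · rw [Nat.cast_zero, Set.zero_smul_set ⟨_, indicatorVec_mem_basePolytope (galeLE_refl C)⟩]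
      ext i
      simp [castVec]
    · have ht' : (t : ℝ) ≠ 0 := Nat.cast_ne_zero.2 ht.ne'
      rw [Set.mem_smul_set_iff_inv_smul_mem₀ ht', castVec_sum, Finset.smul_sum]
      exact (convex_convexHull ℝ _).sum_mem (fun _ _ => by positivity) (by simp [ht']) hmem

theorem ehrhart_basePolytope (C : Finset (Fin n)) (t : ℕ) :
    ehrhart (basePolytope (schubertMatroid C)) t = Nat.card (baseSet (t • columnRank ℤ C)) :=
  ehrhart_eq_card fun _ => castVec_mem_smul_basePolytope_iff

/-- Nonnegativity of the coordinates follows from monotonicity of `thetaColumn`. -/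
theorem schubitope_eq_baseSet (D : Diagram n) :
    D.schubitope = baseSet (∑ j, columnRank ℝ (D j)) := by
  have h1 : ∀ I, (∑ j, columnRank ℝ (D j)) I = (D.theta I : ℝ) := fun I => by
    simp [columnRank, Diagram.theta, Finset.sum_apply]
  have h2 : D.theta Finset.univ = D.size := by simp [Diagram.theta, Diagram.size, thetaColumn_univ]
  ext x
  constructor
  · rintro ⟨-, hs, hI⟩
    exact ⟨by rw [h1, h2, hs], fun I => (hI I).trans_eq (h1 I).symm⟩
  · intro hx
    refine ⟨fun i => ?_, by rw [hx.1, h1, h2], fun I => (hx.2 I).trans_eq (h1 I)⟩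
    refine le_trans (sub_nonneg.2 ?_) (le_mem_baseSet hx i)
    rw [h1, h1]
    exact_mod_cast Finset.sum_le_sum fun j _ => thetaColumn_mono (D j) (Finset.subset_univ _)

theorem ehrhart_schubitope (D : Diagram n) (t : ℕ) :
    ehrhart D.schubitope t = Nat.card (baseSet (∑ j, t • columnRank ℤ (D j))) := by
  refine ehrhart_eq_card fun z => ?_
  rw [schubitope_eq_baseSet, smul_baseSet, Finset.smul_sum]
  · exact castVec_mem_baseSet_iff (by simp [columnRank, Finset.sum_apply])
  · exact ⟨_, sum_mem_baseSet Finset.univ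
      fun j => indicatorVec_mem_baseSet (galeLE_refl (D j))⟩

/-- The sum map on lattice points. -/
def sumMap (D : Diagram n) (t : ℕ) (x : ∀ j, baseSet (t • columnRank ℤ (D j))) :
    baseSet (∑ j, t • columnRank ℤ (D j)) :=
  ⟨∑ j, (x j : Fin n → ℤ), sum_mem_baseSet Finset.univ fun j => (x j).2⟩

theorem sumMap_surjective (D : Diagram n) (t : ℕ) : Function.Surjective (sumMap D t) := by
  rintro ⟨z, hz⟩
  obtain ⟨y, hy, h⟩ := exists_sum_eq_of_mem_baseSet_sum
    (fun j => (isSubmodular_columnRank ℤ (D j)).nsmul t) Finset.univ hz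
  exact ⟨fun j => ⟨y j, hy j (Finset.mem_univ j)⟩, Subtype.ext h⟩

/-- The product formula for the Ehrhart polynomial at `t` holds iff the sum map is injective on
lattice points. -/
theorem ehrhart_eq_prod_iff (D : Diagram n) (t : ℕ) :
    ehrhart D.schubitope t = ∏ j, ehrhart (basePolytope (schubertMatroid (D j))) t
      ↔ Function.Injective (sumMap D t) := by
  have hfin : ∀ j, Finite (baseSet (t • columnRank ℤ (D j))) := fun j => finite_baseSet _
  simp only [ehrhart_schubitope, ehrhart_basePolytope, ← Nat.card_pi]
  constructor
  · intro h
    -- A surjection between finite sets of equal size is injective.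
    exact ((sumMap_surjective D t).bijective_of_nat_card_le h.ge).1
  · intro h
    exact (Nat.card_eq_of_bijective _ ⟨h, sumMap_surjective D t⟩).symm

theorem isLatticeFree_of_card_le_one {D : Diagram n}
    (hD : ∀ i j, i ≠ j → (movableInterval (D i) ∩ movableInterval (D j)).card ≤ 1) :
    IsLatticeFree D.schubitope := by
  have hsub : ∀ j, IsSubmodular (columnRank ℝ (D j)) := fun j => isSubmodular_columnRank ℝ (D j)
  rw [IsLatticeFree, schubitope_eq_baseSet]
  ext x
  constructor
  · rintro ⟨hx, hlat⟩
    refine ⟨hx, ?_⟩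
    rintro y hy w hw ⟨a, b, ha, hb, hab, rfl⟩
    obtain ⟨z, hz⟩ := mem_latticePoints_iff.1 hlat
    rw [← hz] at hx
    obtain ⟨z, hz', rfl⟩ := exists_sum_eq_of_mem_baseSet_sum
      (fun j => isSubmodular_columnRank ℤ (D j)) Finset.univ
      ((castVec_mem_baseSet_iff (by simp [columnRank, Finset.sum_apply])).1 hx)
    obtain ⟨y, hy', rfl⟩ := exists_sum_eq_of_mem_baseSet_sum hsub Finset.univ hy
    obtain ⟨w, hw', rfl⟩ := exists_sum_eq_of_mem_baseSet_sum hsub Finset.univ hw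
    simp only [Finset.mem_univ, true_imp_iff] at hz' hy' hw'
    have hzr : ∀ j, castVec (z j) ∈ baseSet (columnRank ℝ (D j)) := fun j =>
      (castVec_mem_baseSet_iff (by simp [columnRank])).2 (hz' j)
    -- Uniqueness over ℝ transfers the convex combination to each column, where the integral point
    -- is a 0/1 vector in the unit cube and hence extreme.
    have key := eq_of_sum_eq_sum hD (t := 1) (x := fun j => castVec (z j))
      (y := fun j => a • y j + b • w j)
      (fun j => by simpa using hzr j)
      (fun j => by simpa using convex_baseSet _ (hy' j) (hw' j) ha.le hb.le hab)
      (by rw [← castVec_sum, hz, Finset.sum_add_distrib, Finset.smul_sum, Finset.smul_sum])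
    rw [← hz, castVec_sum]
    refine Finset.sum_congr rfl fun j _ => ?_
    ext i
    obtain ⟨T, -, hT⟩ := exists_galeLE_of_mem_baseSet_columnRank (hz' j)
    have h1 := congrFun (congrFun key j) i
    have hy0 := nonneg_of_mem_baseSet_columnRank (hy' j) i
    have hy1 := le_one_of_mem_baseSet_columnRank (hy' j) i
    have hw0 := nonneg_of_mem_baseSet_columnRank (hw' j) i
    have hw1 := le_one_of_mem_baseSet_columnRank (hw' j) i
    simp only [Pi.add_apply, Pi.smul_apply, smul_eq_mul, hT, castVec_indicatorVec] at h1 ⊢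
    by_cases hi : i ∈ T <;> simp only [indicatorVec, hi, if_true, if_false] at h1 ⊢
    · refine le_antisymm hy1 (not_lt.1 fun h => ?_)
      nlinarith [mul_lt_mul_of_pos_left h ha, mul_le_mul_of_nonneg_left hw1 hb.le]
    · refine le_antisymm (not_lt.1 fun h => ?_) hy0
      nlinarith [mul_pos ha h, mul_nonneg hb.le hw0]
  · intro hx
    refine ⟨hx.1, exists_int_of_mem_extremePoints (.sum _ hsub) (fun X => ?_) hx⟩
    exact ⟨∑ j, (thetaColumn (D j) X : ℤ), by simp [columnRank, Finset.sum_apply]⟩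

/-- With `B` the common part, `B + e a + e b` is a lattice point halfway between `B + 2 e a` and `B
+ 2 e b`. -/
theorem not_isLatticeFree_of_one_lt_card {D : Diagram n} {i j : Fin n} (hij : i ≠ j)
    (h : 1 < (movableInterval (D i) ∩ movableInterval (D j)).card) :
    ¬ IsLatticeFree D.schubitope := by
  obtain ⟨a, b, B, T, hab, hT, -, -, hsum⟩ := exists_exchange_of_one_lt_card hij h
  intro hfree
  have hmem : ∀ p q, (p = a ∨ p = b) → (q = a ∨ q = b) →
      ∑ k, indicatorVec ℝ (T p q k) ∈ D.schubitope := fun p q hp hq => by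
    rw [schubitope_eq_baseSet]
    exact sum_mem_baseSet Finset.univ fun k => indicatorVec_mem_baseSet (hT p q hp hq k)
  have hlat : ∑ k, indicatorVec ℝ (T a b k) ∈ latticePoints n :=
    mem_latticePoints_iff.2 ⟨∑ k, indicatorVec ℤ (T a b k), by
      simp [castVec_sum, castVec_indicatorVec]⟩
  have hext : ∑ k, indicatorVec ℝ (T a b k) ∈ D.schubitope.extremePoints ℝ :=
    hfree ▸ ⟨hmem a b (.inl rfl) (.inr rfl), hlat⟩
  have h1 := hext.2 (hmem a a (.inl rfl) (.inl rfl)) (hmem b b (.inr rfl) (.inr rfl))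
    ⟨1 / 2, 1 / 2, by norm_num, by norm_num, by norm_num, by
      rw [hsum a a (.inl rfl) (.inl rfl), hsum b b (.inr rfl) (.inr rfl),
        hsum a b (.inl rfl) (.inr rfl)]
      ext k
      simp only [Pi.add_apply, Pi.smul_apply, smul_eq_mul]
      ring⟩
  rw [hsum a a (.inl rfl) (.inl rfl), hsum a b (.inl rfl) (.inr rfl)] at h1
  simpa [hab] using congrFun (add_left_cancel h1) a

/-- Swapping `a` and `b` between the two columns changes the decomposition but not the sum. -/
theorem not_injective_sumMap_of_one_lt_card {D : Diagram n} {i j : Fin n} (hij : i ≠ j)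
    (h : 1 < (movableInterval (D i) ∩ movableInterval (D j)).card) :
    ¬ Function.Injective (sumMap D 1) := by
  obtain ⟨a, b, B, T, hab, hT, haT, haT', hsum⟩ := exists_exchange_of_one_lt_card hij h
  intro hinj
  have hmem : ∀ p q, (p = a ∨ p = b) → (q = a ∨ q = b) → ∀ k,
      indicatorVec ℤ (T p q k) ∈ baseSet (1 • columnRank ℤ (D k)) := fun p q hp hq k => by
    rw [one_smul]
    exact indicatorVec_mem_baseSet (hT p q hp hq k)
  have h1 := @hinj (fun k => ⟨_, hmem a b (.inl rfl) (.inr rfl) k⟩)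
    (fun k => ⟨_, hmem b a (.inr rfl) (.inl rfl) k⟩) (Subtype.ext (by
      simp only [sumMap]
      rw [hsum a b (.inl rfl) (.inr rfl), hsum b a (.inr rfl) (.inl rfl), add_right_comm]))
  have h2 := congrFun (congrArg Subtype.val (congrFun h1 i)) a
  simp [indicatorVec, haT, haT'] at h2

end Lattice

end Schubitope

theorem theorem1p1 (n : ℕ) (D : Schubitope.Diagram n) :
    List.TFAE
      [Schubitope.IsLatticeFree D.schubitope,
        ∀ i j : Fin n, i < j →
          (Schubitope.movableInterval (D i) ∩ Schubitope.movableInterval (D j)).card ≤ 1,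
        ∀ t : ℕ, Schubitope.ehrhart D.schubitope t =
          ∏ j : Fin n, Schubitope.ehrhart
            (Schubitope.basePolytope (Schubitope.schubertMatroid (D j))) t] := by
  have hsymm : (∀ i j : Fin n, i < j →
      (Schubitope.movableInterval (D i) ∩ Schubitope.movableInterval (D j)).card ≤ 1) →
      ∀ i j : Fin n, i ≠ j →
      (Schubitope.movableInterval (D i) ∩ Schubitope.movableInterval (D j)).card ≤ 1 := by
    intro h i j hij
    rcases lt_or_gt_of_ne hij with hlt | hlt
    · exact h i j hlt
    · rw [Finset.inter_comm]
      exact h j i hlt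
  tfae_have 1 → 2 := fun h i j hij => by
    by_contra! hc
    exact Schubitope.not_isLatticeFree_of_one_lt_card hij.ne hc h
  tfae_have 2 → 1 := fun h => Schubitope.isLatticeFree_of_card_le_one (hsymm h)
  tfae_have 2 → 3 := fun h t => (Schubitope.ehrhart_eq_prod_iff D t).2 fun x y hxy => by
    have := Schubitope.eq_of_sum_eq_sum (hsymm h) (fun j => (x j).2) (fun j => (y j).2)
      (congrArg Subtype.val hxy)
    exact funext fun j => Subtype.ext (congrFun this j)
  tfae_have 3 → 2 := fun h i j hij => by
    by_contra! hc
    exact Schubitope.not_injective_sumMap_of_one_lt_card hij.ne hc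
      ((Schubitope.ehrhart_eq_prod_iff D 1).1 (h 1))
  tfae_finish
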